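/- **Setting.** Let $(E,J)$ be a site with finite products (for instance a topos), $F_1=E$, and let $n\ge 2$. An *abelian tower of torsors* $F_n\to F_{n-1}\to\dots\to F_1$ over $(E,J)$ consists of categories $F_k(U)$ for $U\in E$ (the objects of $F_k$ over $U$ and the arrows over $\mathrm{id}_U$; $F_1(U)$ has the single object $U$ and its identity), strictly functorial restrictions $F_k(U)\to F_k(V)$ for $V\to U$, functors $p_{k}:F_{k}\to F_{k-1}$ compatible with restriction, and sheaves of abelian groups $L_2,\dots,L_n$ and $L'_3,\dots,L'_n$ on $E$, such that: 1. $F_2\to F_1$ is a gerbe (a stack in groupoids, locally non-empty, with any two objects locally isomorphic), with link $L_2$ in the sense of 3. 2. Arrows of $F_k(U)$ that $p_k$ sends to an identity are invertible. 3. For $x\in F_k(U)$ there is an isomorphism of $L_k(U)$ with the group of automorphisms of $x$ over the identity of $p_k(x)$, compatible with restriction and with the arrows $x\to y$ of $F_k(U)$ that $p_k$ sends to an identity. 4. $p_k:F_k(U)\to F_{k-1}(U)$ is a fibred category: every arrow has cartesian lifts, and cartesian arrows compose. 5. For $x\in F_k(U)$, $k\ge 3$, there is an isomorphism of $L'_k(U)$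 with the group of automorphisms of $x$ over the identity of $p_{k-1}p_k(x)$, compatible with restriction and with the arrows $x\to y$ of $F_k(U)$ over an identity of $F_{k-2}(U)$. 6. Say that the tower is *connected over* $V$ if any two objects $x,y$ of the same $F_k(V)$ are related by an isomorphism $u$ which projects to the identity in every lower $F_j(V)$ in which $x$ and $y$ have the same image, and which, together with its images in the lower $F_j(V)$, commutes with the actions of the sheaves $L_j$ and $L'_j$. Every object of $E$ has a covering by objects over which the tower is connected. 7. Every object of $E$ has a covering by objects $V$ for which all $F_k(V)$ are non-empty. Let $(X_i)_{i\in I}$ be a *contractible* covering family of the final object, that is: all $F_k(X_i)$ are non-empty, and the tower is connected over every finite (non-empty) fibre product $X_{i_1\dots i_m}=X_{i_1}\times\dots\times X_{i_m}$ over the final object. **Classifying cocycles.** Choose objects $x_i\in F_2(X_i)$ and isomorphisms $g_{ij}:x_j\to x_i$ over $X_{ij}$, and put $c_2=(c_{i_1i_2i_3})$, where $c_{i_1i_2i_3}\in L_2(X_{i_1i_2i_3})$ is the section that acts as the automorphism $g_{i_3i_1}g_{i_1i_2}g_{i_2i_3}$, $g_{i_3i_1}=g_{i_1i_3}^{-1}$,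 of the restriction $x_{i_1i_2i_3}$ of $x_{i_3}$. If $c_l=(c_{i_1\dots i_{l+1}})$ has been constructed as a cochain with values in $L_l$, acting on objects $x_{i_1\dots i_{l+1}}\in F_l(X_{i_1\dots i_{l+1}})$, choose objects $x_{i_1\dots i_{l+2}}\in F_{l+1}(X_{i_1\dots i_{l+2}})$ over the restrictions of the $x_{i_1\dots i_{l+1}}$, and lifts $(c_{i_1\dots i_{l+1}})^*$, i.e. sections of $L'_{l+1}$ over $X_{i_1\dots i_{l+1}}$ whose restrictions act on the $x_{i_1\dots i_{l+2}}$ by lifts of the automorphisms given by the restrictions of the $c_{i_1\dots i_{l+1}}$. Then $c_{i_1\dots i_{l+2}}\in L_{l+1}(X_{i_1\dots i_{l+2}})$ is the section that acts on $x_{i_1\dots i_{l+2}}$ as $\sum_{j=1}^{l+2}(-1)^{j+1}(c_{i_1\dots\hat{\imath}_j\dots i_{l+2}})^*$. **Proposition 4.** For every $2\le l\le n$, in particular for $l=n$, such choices exist; every cochain $c_l$ so obtained is a Čech cocycle; and its class in the Čech cohomology group $\check H^l((X_i)_{i\in I},L_l)$ does not depend on the choices, neither on the objects $x_i$ and the isomorphisms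 $g_{ij}$, nor on the objects $x_{i_1\dots i_{j+2}}$ and the lifts $(c_{i_1\dots i_{j+1}})^*$, $2\le j<l$. -/

import Mathlib

open CategoryTheory CategoryTheory.Limits Opposite

universe v u v' u' w t

/-! ### Čech cohomology of a presheaf of abelian groups for a family of objects

The category `E` has finite products; `X : ι → E` is a family of objects (in the application a
covering of the final object, so that products are the fibre products over it). -/

namespace Cech

variable {E : Type u} [Category.{v} E] [HasFiniteProducts E] {ι : Type t}

/-- The product `X_{s 0} × ⋯ × X_{s (m-1)}`, the fibre product over the final object. -/
noncomputable abbrev inter (X : ι → E) {m : ℕ} (s : Fin m → ι) : E :=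
  ∏ᶜ fun a => X (s a)

/-- The projection `X_{s 0} × ⋯ × X_{s (m-1)} ⟶ X_{s a}`. -/
noncomputable abbrev pr (X : ι → E) {m : ℕ} (s : Fin m → ι) (a : Fin m) : inter X s ⟶ X (s a) :=
  Pi.π (fun b => X (s b)) a

/-- The projection that forgets the index in position `j`. -/
noncomputable def face (X : ι → E) {m : ℕ} (s : Fin (m + 1) → ι) (j : Fin (m + 1)) :
    inter X s ⟶ inter X (fun a => s (j.succAbove a)) :=
  Pi.lift fun a => pr X s (j.succAbove a)

/-- The projection onto `X_{s a} × X_{s b}`. -/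
noncomputable def pairMap (X : ι → E) {m : ℕ} (s : Fin m → ι) (a b : Fin m) :
    inter X s ⟶ inter X ![s a, s b] :=
  Pi.lift (Fin.cons (pr X s a) (Fin.cons (pr X s b) finZeroElim))

/-- The first projection of `X_i × X_j`. -/
noncomputable def fst (X : ι → E) (i j : ι) : inter X ![i, j] ⟶ X i := pr X ![i, j] 0

/-- The second projection of `X_i × X_j`. -/
noncomputable def snd (X : ι → E) (i j : ι) : inter X ![i, j] ⟶ X j := pr X ![i, j] 1

theorem pairMap_fst (X : ι → E) {m : ℕ} (s : Fin m → ι) (a b : Fin m) :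
    pairMap X s a b ≫ fst X (s a) (s b) = pr X s a :=
  Pi.lift_π (f := fun c => X (![s a, s b] c)) _ 0

theorem pairMap_snd (X : ι → E) {m : ℕ} (s : Fin m → ι) (a b : Fin m) :
    pairMap X s a b ≫ snd X (s a) (s b) = pr X s b :=
  Pi.lift_π (f := fun c => X (![s a, s b] c)) _ 1

/-- Čech `m`-cochains: families of sections `c_{i_0 … i_m}` over `X_{i_0} × ⋯ × X_{i_m}`. -/
abbrev Cochain (X : ι → E) (P : Eᵒᵖ ⥤ AddCommGrpCat.{w}) (m : ℕ) : Type max t w :=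
  ∀ s : Fin (m + 1) → ι, P.obj (op (inter X s))

/-- The Čech differential: `(dc)_{i_0 … i_{m+1}}` is the alternating sum over `j` of the
restrictions of the sections `c` at the tuples with `i_j` omitted. -/
noncomputable def d (X : ι → E) (P : Eᵒᵖ ⥤ AddCommGrpCat.{w}) (m : ℕ) :
    Cochain X P m →+ Cochain X P (m + 1) where
  toFun c s := ∑ j : Fin (m + 2),
    (-1 : ℤ) ^ (j : ℕ) • (P.map (face X s j).op).hom (c fun a => s (j.succAbove a))
  map_zero' := by funext s; simp
  map_add' c c' := by funext s; simp [Finset.sum_add_distrib]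

/-- Čech `m`-cocycles. -/
noncomputable def cocycles (X : ι → E) (P : Eᵒᵖ ⥤ AddCommGrpCat.{w}) (m : ℕ) :
    AddSubgroup (Cochain X P m) :=
  (d X P m).ker

/-- Čech `m`-coboundaries. -/
noncomputable def coboundaries (X : ι → E) (P : Eᵒᵖ ⥤ AddCommGrpCat.{w}) :
    ∀ m : ℕ, AddSubgroup (Cochain X P m)
  | 0 => ⊥
  | m + 1 => (d X P m).range

/-- The Čech cohomology group of degree `m` of `P` for the family `X`. -/
abbrev Cohomology (X : ι → E) (P : Eᵒᵖ ⥤ AddCommGrpCat.{w}) (m : ℕ) : Type max t w :=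
  cocycles X P m ⧸ (coboundaries X P m).addSubgroupOf (cocycles X P m)

/-- The Čech cohomology class of a cocycle. -/
noncomputable def cohomologyClass (X : ι → E) (P : Eᵒᵖ ⥤ AddCommGrpCat.{w}) (m : ℕ)
    (c : cocycles X P m) : Cohomology X P m :=
  QuotientAddGroup.mk c

end Cech

/-! ### Gerbes -/

/-- A sheaf of categories over `(E, J)`, with strictly functorial restrictions, is a gerbe if it is
a stack whose fibres are groupoids, has objects locally, and any two objects are locally
isomorphic. -/
structure IsGerbe {E : Type u} [Category.{v} E] (J : GrothendieckTopology E)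
    (C : Eᵒᵖ ⥤ Cat.{v', u'}) : Prop where
  isStack : C.toPseudofunctor'.IsStack J
  isIso : ∀ (U : E) {x y : C.obj (op U)} (f : x ⟶ y), IsIso f
  locally_nonempty : ∀ U : E, ∃ S ∈ J U, ∀ ⦃V : E⦄ (f : V ⟶ U), S.arrows f →
    Nonempty (C.obj (op V))
  locally_isomorphic : ∀ (U : E) (x y : C.obj (op U)), ∃ S ∈ J U,
    ∀ ⦃V : E⦄ (f : V ⟶ U), S.arrows f →
      Nonempty ((C.map f.op).toFunctor.obj x ≅ (C.map f.op).toFunctor.obj y)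

/-! ### Towers of torsors -/

/-- The data of a tower `F_n ⟶ ⋯ ⟶ F_2 ⟶ F_1` over the site `(E, J)`, where `F_1 = E`, together
with the sheaves of abelian groups that act on it. Each stage is given by its fibres over the
objects of `E` and strictly functorial restrictions.

Indices are shifted so as to start at `0`:
* `F k` is the stage `F_{k+1}`: `(F k).obj (op U)` is the category of the objects of
  `F_{k+1}` that project to `U` and of the arrows between them that project to `𝟙 U`;
* `p k` is the functor `F_{k+2} ⟶ F_{k+1}`;
* `L k` is the sheaf `L_{k+2}`, and `act k U x` its action on an object `x` of `F_{k+2}` over `U`;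
* `L' k` is the sheaf `L'_{k+3}`, and `act' k U x` its action on an object `x` of `F_{k+3}` over
  `U`.

Only finitely many stages matter for a tower of height `n`; the others are padding. -/
structure TowerData {E : Type u} [Category.{v} E] (J : GrothendieckTopology E) where
  F : ℕ → Eᵒᵖ ⥤ Cat.{v', u'}
  p : ∀ k, F (k + 1) ⟶ F k
  L : ℕ → Sheaf J AddCommGrpCat.{w}
  L' : ℕ → Sheaf J AddCommGrpCat.{w}
  act : ∀ (k : ℕ) (U : E) (x : (F (k + 1)).obj (op U)),
    Multiplicative ((L k).obj.obj (op U)) →* Aut x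
  act' : ∀ (k : ℕ) (U : E) (x : (F (k + 2)).obj (op U)),
    Multiplicative ((L' k).obj.obj (op U)) →* Aut x

namespace TowerData

variable {E : Type u} [Category.{v} E] {J : GrothendieckTopology E}
  (T : TowerData.{v, u, v', u', w} J)

/-- The fibre over `U` of the stage `k`. -/
abbrev Fib (k : ℕ) (U : E) : Type u' := (T.F k).obj (op U)

/-- Restriction along `f : V ⟶ U`. -/
abbrev res (k : ℕ) {U V : E} (f : V ⟶ U) : T.Fib k U ⥤ T.Fib k V :=
  ((T.F k).map f.op).toFunctor

/-- The projection of the stage `k + 1` to the stage `k` over `U`. -/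
abbrev proj (k : ℕ) (U : E) : T.Fib (k + 1) U ⥤ T.Fib k U :=
  ((T.p k).app (op U)).toFunctor

theorem res_obj_comp (k : ℕ) {U V W : E} (g : W ⟶ V) (f : V ⟶ U) (h : W ⟶ U)
    (e : g ≫ f = h) (x : T.Fib k U) :
    (T.res k g).obj ((T.res k f).obj x) = (T.res k h).obj x := by
  subst e
  simp [res]

/-- The automorphism of `x` given by a section of the sheaf `L k`. -/
abbrev aut (k : ℕ) {U : E} (x : T.Fib (k + 1) U) (a : (T.L k).obj.obj (op U)) : x ⟶ x :=
  (T.act k U x (Multiplicative.ofAdd a)).hom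

/-- The automorphism of `x` given by a section of the sheaf `L' k`. -/
abbrev aut' (k : ℕ) {U : E} (x : T.Fib (k + 2) U) (a : (T.L' k).obj.obj (op U)) : x ⟶ x :=
  (T.act' k U x (Multiplicative.ofAdd a)).hom

/-- An isomorphism `u : x ≅ y` of a stage is *admissible* if, for each of the lower stages in which
`x` and `y` have the same image, the image of `u` is the identity, and if `u` and its images in the
lower stages commute with the actions of the sheaves `L` and `L'`. -/
def Admissible {U : E} : ∀ (k : ℕ) {x y : T.Fib k U}, (x ≅ y) → Prop
  | 0, _, _, _ => True
  | 1, x, y, u =>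
      (∀ h : (T.proj 0 U).obj x = (T.proj 0 U).obj y, (T.proj 0 U).map u.hom = eqToHom h) ∧
      ∀ a, T.aut 0 x a ≫ u.hom = u.hom ≫ T.aut 0 y a
  | k + 2, x, y, u =>
      Admissible (k + 1) ((T.proj (k + 1) U).mapIso u) ∧
      (∀ h : (T.proj (k + 1) U).obj x = (T.proj (k + 1) U).obj y,
        (T.proj (k + 1) U).map u.hom = eqToHom h) ∧
      (∀ a, T.aut (k + 1) x a ≫ u.hom = u.hom ≫ T.aut (k + 1) y a) ∧
      ∀ a, T.aut' k x a ≫ u.hom = u.hom ≫ T.aut' k y a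

/-- The tower of height `n` is connected over `V`: any two objects of the same stage over `V` are
related by an admissible isomorphism. -/
def ConnectedOver (n : ℕ) (V : E) : Prop :=
  ∀ k < n, ∀ x y : T.Fib k V, ∃ u : x ≅ y, T.Admissible k u

/-- Every stage of the tower of height `n` has an object over `V`. -/
def NonemptyOver (n : ℕ) (V : E) : Prop :=
  ∀ k < n, Nonempty (T.Fib k V)

/-- `T` is an abelian tower of torsors `F_n ⟶ ⋯ ⟶ F_1` of height `n`, with sheaves
`L_2, …, L_n`. -/
structure IsAbelianTowerOfTorsors (n : ℕ) : Prop where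
  /-- The lowest stage is the base: over `U` it has the one object `U` and its identity. -/
  base_obj : ∀ U : E, Nonempty (Unique (T.Fib 0 U))
  base_hom : ∀ (U : E) (x y : T.Fib 0 U), Subsingleton (x ⟶ y)
  /-- `F_2 ⟶ F_1` is a gerbe (its link is `L_2`, by the conditions on the action below). -/
  gerbe : 2 ≤ n → IsGerbe J (T.F 1)
  /-- Arrows that project to an identity are invertible. -/
  isIso_of_id : ∀ k, k + 2 ≤ n → ∀ (U : E) (z : T.Fib k U) {x y : T.Fib (k + 1) U} (f : x ⟶ y),
    (T.proj k U).IsHomLift (𝟙 z) f → IsIso f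
  /-- `L_{k+2}` acts on `x` as the group of the automorphisms over the identity of the image of `x`
  in the stage below. -/
  act_injective : ∀ k, k + 2 ≤ n → ∀ (U : E) (x : T.Fib (k + 1) U),
    Function.Injective (T.act k U x)
  act_range : ∀ k, k + 2 ≤ n → ∀ (U : E) (x : T.Fib (k + 1) U) (f : Aut x),
    f ∈ (T.act k U x).range ↔ (T.proj k U).map f.hom = 𝟙 _
  /-- It acts on each fibre category by automorphisms of the category: natural in `x`. -/
  act_natural : ∀ k, k + 2 ≤ n → ∀ (U : E) (z : T.Fib k U) {x y : T.Fib (k + 1) U} (f : x ⟶ y),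
    (T.proj k U).IsHomLift (𝟙 z) f → ∀ a, T.aut k x a ≫ f = f ≫ T.aut k y a
  act_res : ∀ k, k + 2 ≤ n → ∀ {U V : E} (f : V ⟶ U) (x : T.Fib (k + 1) U)
    (a : (T.L k).obj.obj (op U)),
    T.aut k ((T.res (k + 1) f).obj x) (((T.L k).obj.map f.op).hom a) =
      (T.res (k + 1) f).map (T.aut k x a)
  /-- Arrows `m` of a stage (over an identity of the base) have cartesian lifts `m^*` to the next
  stage, and cartesian arrows compose; so `(mn)^*` and `m^* n^*` differ by an automorphism over the
  identity. -/
  fibered : ∀ k, k + 2 ≤ n → ∀ U : E, (T.proj k U).IsFibered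
  /-- Local connectedness: every object has a covering by objects over which the tower is
  connected. -/
  locally_connected : ∀ U : E,
    Sieve.generate ((fun V _ => T.ConnectedOver n V) : Presieve U) ∈ J U
  /-- `L'_{k+3}`, a sheaf of abelian groups, acts on `x` as the group of the automorphisms over the
  identity of the image of `x` two stages below. -/
  act'_injective : ∀ k, k + 3 ≤ n → ∀ (U : E) (x : T.Fib (k + 2) U),
    Function.Injective (T.act' k U x)
  act'_range : ∀ k, k + 3 ≤ n → ∀ (U : E) (x : T.Fib (k + 2) U) (f : Aut x),
    f ∈ (T.act' k U x).range ↔ (T.proj (k + 1) U ⋙ T.proj k U).map f.hom = 𝟙 _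
  act'_natural : ∀ k, k + 3 ≤ n → ∀ (U : E) (z : T.Fib k U) {x y : T.Fib (k + 2) U} (f : x ⟶ y),
    (T.proj (k + 1) U ⋙ T.proj k U).IsHomLift (𝟙 z) f →
      ∀ a, T.aut' k x a ≫ f = f ≫ T.aut' k y a
  act'_res : ∀ k, k + 3 ≤ n → ∀ {U V : E} (f : V ⟶ U) (x : T.Fib (k + 2) U)
    (a : (T.L' k).obj.obj (op U)),
    T.aut' k ((T.res (k + 2) f).obj x) (((T.L' k).obj.map f.op).hom a) =
      (T.res (k + 2) f).map (T.aut' k x a)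
  /-- Every object has a covering by objects over which all stages have objects. -/
  locally_nonempty : ∀ U : E,
    Sieve.generate ((fun V _ => T.NonemptyOver n V) : Presieve U) ∈ J U

variable [HasFiniteProducts E] {ι : Type t} (X : ι → E)

/-- A contractible covering family of the final object for the tower of height `n`: all stages have
objects over the members of the family, and over every finite (non-empty) fibre product of members
the tower is connected. -/
structure IsContractibleCover (n : ℕ) : Prop where
  covers : J.CoversTop X
  nonempty : ∀ i, T.NonemptyOver n (X i)
  connected : ∀ (m : ℕ) (s : Fin (m + 1) → ι), T.ConnectedOver n (Cech.inter X s)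

variable {X}

/-- Given objects `x_i` of `F_2` over `X_i` and arrows `g_{ij} : x_j ⟶ x_i` over `X_i × X_j`, the
restriction of `g_{s a, s b}` to the product `X_{s 0} × X_{s 1} × X_{s 2}`. -/
noncomputable def gRes (x : ∀ i, T.Fib 1 (X i))
    (g : ∀ i j, (T.res 1 (Cech.snd X i j)).obj (x j) ≅ (T.res 1 (Cech.fst X i j)).obj (x i))
    (s : Fin 3 → ι) (a b : Fin 3) :
    (T.res 1 (Cech.pr X s b)).obj (x (s b)) ≅ (T.res 1 (Cech.pr X s a)).obj (x (s a)) :=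
  eqToIso (T.res_obj_comp 1 _ _ _ (Cech.pairMap_snd X s a b) (x (s b))).symm ≪≫
    (T.res 1 (Cech.pairMap X s a b)).mapIso (g (s a) (s b)) ≪≫
    eqToIso (T.res_obj_comp 1 _ _ _ (Cech.pairMap_fst X s a b) (x (s a)))

/-- The automorphism `g_{ki} g_{ij} g_{jk}` of the restriction of `x_k` to `X_i × X_j × X_k`, where
`g_{ki}` is the inverse of `g_{ik}` and `(i, j, k) = (s 0, s 1, s 2)`. -/
noncomputable def giraud (x : ∀ i, T.Fib 1 (X i))
    (g : ∀ i j, (T.res 1 (Cech.snd X i j)).obj (x j) ≅ (T.res 1 (Cech.fst X i j)).obj (x i))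
    (s : Fin 3 → ι) :
    (T.res 1 (Cech.pr X s 2)).obj (x (s 2)) ≅ (T.res 1 (Cech.pr X s 2)).obj (x (s 2)) :=
  T.gRes x g s 1 2 ≪≫ T.gRes x g s 0 1 ≪≫ (T.gRes x g s 0 2).symm

variable (X)

/-- `T.IsClassifying X k x c` says that the cochain `c = c_{k+2}`, of degree `k + 2` with values in
`L_{k+2}`, is obtained by the construction of the classifying cocycles from some choices, and that
`x` is the family of the objects `x_{i_1 … i_{k+3}}` of `F_{k+2}` on which `c_{i_1 … i_{k+3}}` acts.
-/
inductive IsClassifying : ∀ k : ℕ, (∀ s : Fin (k + 2 + 1) → ι, T.Fib (k + 1) (Cech.inter X s)) →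
    Cech.Cochain X (T.L k).obj (k + 2) → Prop
  /-- Choose objects `x_i` over `X_i` and isomorphisms `g_{ij} : x_j ≅ x_i` over `X_i × X_j`; the
  section `c_{ijk}` is the one that acts on the restriction of `x_k` as `g_{ki} g_{ij} g_{jk}`. -/
  | base (x : ∀ i, T.Fib 1 (X i))
      (g : ∀ i j, (T.res 1 (Cech.snd X i j)).obj (x j) ≅ (T.res 1 (Cech.fst X i j)).obj (x i))
      (c : Cech.Cochain X (T.L 0).obj 2)
      (hc : ∀ s, T.act 0 _ ((T.res 1 (Cech.pr X s 2)).obj (x (s 2))) (Multiplicative.ofAdd (c s)) =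
        T.giraud x g s) :
      IsClassifying 0 (fun s => (T.res 1 (Cech.pr X s 2)).obj (x (s 2))) c
  /-- Given `c = c_l` with the objects `x_{i_1 … i_{l+1}}`, choose objects `y_{i_1 … i_{l+2}}` of
  `F_{l+1}` over the restrictions of the `x_{i_1 … i_{l+1}}`, and lifts `(c_{i_1 … i_{l+1}})^*`, that
  is sections of `L'_{l+1}` over `X_{i_1 … i_{l+1}}` whose restrictions act on the `y_{i_1 … i_{l+2}}`
  by automorphisms over those given by the `c_{i_1 … i_{l+1}}`. The section `c_{i_1 … i_{l+2}}` is the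
  one that acts on `y_{i_1 … i_{l+2}}` as the alternating sum of the restricted lifts. -/
  | step (k : ℕ) (x : ∀ s : Fin (k + 2 + 1) → ι, T.Fib (k + 1) (Cech.inter X s))
      (c : Cech.Cochain X (T.L k).obj (k + 2)) (h : IsClassifying k x c)
      (y : ∀ s : Fin (k + 3 + 1) → ι, T.Fib (k + 2) (Cech.inter X s))
      (hy : ∀ s, (T.proj (k + 1) _).obj (y s) =
        (T.res (k + 1) (Cech.face X s (Fin.last _))).obj
          (x fun a => s ((Fin.last _).succAbove a)))
      (lift : Cech.Cochain X (T.L' k).obj (k + 2))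
      (hlift : ∀ (s : Fin (k + 3 + 1) → ι) (j : Fin (k + 3 + 1)),
        (T.proj (k + 1) _).map (T.aut' k (y s)
          (((T.L' k).obj.map (Cech.face X s j).op).hom (lift fun a => s (j.succAbove a)))) =
        T.aut k ((T.proj (k + 1) _).obj (y s))
          (((T.L k).obj.map (Cech.face X s j).op).hom (c fun a => s (j.succAbove a))))
      (c' : Cech.Cochain X (T.L (k + 1)).obj (k + 3))
      (hc' : ∀ s, T.aut (k + 1) (y s) (c' s) =
        T.aut' k (y s) (∑ j : Fin (k + 3 + 1), (-1 : ℤ) ^ (j : ℕ) •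
          ((T.L' k).obj.map (Cech.face X s j).op).hom (lift fun a => s (j.succAbove a)))) :
      IsClassifying (k + 1) y c'

end TowerData

/-! Over a product of members of the covering the tower is connected and non-empty. There `L_{k+3}`,
`L'_{k+3}` and `L_{k+2}` act on an object `x` as the automorphisms over the identity one stage
below, those over the identity two stages below, and the automorphisms of the image of `x` over the
identity. Projecting automorphisms therefore gives a short exact sequence of sections 0 → `L_{k+3}`
→ `L'_{k+3}` → `L_{k+2}` → 0. Surjectivity comes from cartesian lifts corrected by admissible
isomorphisms (`exists_aut'_over`); admissible isomorphisms also make the maps independent of `x`.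
The maps commute with face restrictions, so they form a short exact sequence of Čech complexes.
Passing from `c_l` to `c_{l+1}` is exactly the recipe for its connecting homomorphism
(`IsClassifying.exists_connecting`): lift to `L'`, apply the differential, pull back to the kernel.
Being a cocycle, and independence of the choices up to coboundaries, are then the usual diagram
chases. The induction starts in degree 2 with the cocycle of a gerbe, where both facts are computed
directly from the centrality of `L_2` (`d_eq_zero_of_giraud`, `sub_mem_range_of_giraud`). -/

namespace Cech

/-! ### Čech cochains: reindexing and the square of the differential. -/

variable {E : Type u} [Category.{v} E] [HasFiniteProducts E] {ι : Type t}

/-- The projection `X_s ⟶ X_{s ∘ φ}` given by a map of index sets; `face` is a special case. -/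
noncomputable def reindex (X : ι → E) {l m : ℕ} (s : Fin m → ι) (φ : Fin l → Fin m) :
    inter X s ⟶ inter X (fun a => s (φ a)) :=
  Pi.lift fun a => pr X s (φ a)

theorem reindex_pr (X : ι → E) {l m : ℕ} (s : Fin m → ι) (φ : Fin l → Fin m) (a : Fin l) :
    reindex X s φ ≫ pr X (fun a => s (φ a)) a = pr X s (φ a) :=
  Pi.lift_π _ _

theorem reindex_comp (X : ι → E) {l m r : ℕ} (s : Fin r → ι) (φ : Fin m → Fin r)
    (ψ : Fin l → Fin m) :
    reindex X s φ ≫ reindex X (fun a => s (φ a)) ψ = reindex X s (fun a => φ (ψ a)) := by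
  apply Pi.hom_ext
  intro a
  simp [reindex]

theorem reindex_pairMap (X : ι → E) {l m : ℕ} (s : Fin m → ι) (φ : Fin l → Fin m) (a b : Fin l) :
    reindex X s φ ≫ pairMap X (fun a => s (φ a)) a b = pairMap X s (φ a) (φ b) := by
  apply Pi.hom_ext
  intro c
  fin_cases c
  · exact (Category.assoc _ _ _).trans ((congrArg _ (pairMap_fst X (fun a => s (φ a)) a b)).trans
      ((reindex_pr X s φ a).trans (pairMap_fst X s (φ a) (φ b)).symm))
  · exact (Category.assoc _ _ _).trans ((congrArg _ (pairMap_snd X (fun a => s (φ a)) a b)).trans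
      ((reindex_pr X s φ b).trans (pairMap_snd X s (φ a) (φ b)).symm))

/-- The restriction of the section `c_{s ∘ φ}` of a cochain to `X_s`. -/
noncomputable def pull (X : ι → E) (P : Eᵒᵖ ⥤ AddCommGrpCat.{w}) {l m : ℕ} (c : Cochain X P l)
    (s : Fin m → ι) (φ : Fin (l + 1) → Fin m) : P.obj (op (inter X s)) :=
  (P.map (reindex X s φ).op).hom (c fun a => s (φ a))

theorem d_apply (X : ι → E) (P : Eᵒᵖ ⥤ AddCommGrpCat.{w}) {m : ℕ} (c : Cochain X P m)
    (s : Fin (m + 2) → ι) :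
    d X P m c s = ∑ j : Fin (m + 2), (-1 : ℤ) ^ (j : ℕ) • pull X P c s j.succAbove := rfl

theorem map_pull (X : ι → E) (P : Eᵒᵖ ⥤ AddCommGrpCat.{w}) {l m r : ℕ} (c : Cochain X P l)
    (s : Fin r → ι) (φ : Fin m → Fin r) (ψ : Fin (l + 1) → Fin m) :
    (P.map (reindex X s φ).op).hom (pull X P c (fun a => s (φ a)) ψ) =
      pull X P c s (fun a => φ (ψ a)) := by
  have h := congrArg (fun f => (P.map f.op).hom (c fun a => s (φ (ψ a)))) (reindex_comp X s φ ψ)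
  simpa [pull] using h

/-- The pairs `(j, i)` with `i < j` are matched with the pairs `(i, j - 1)`, which omit the same two
positions and carry the opposite sign. -/
theorem sum_neg_one_pow_succAbove_comp {G : Type*} [AddCommGroup G] {m : ℕ}
    (T : (Fin (m + 1) → Fin (m + 3)) → G) :
    ∑ j : Fin (m + 3), (-1 : ℤ) ^ (j : ℕ) • ∑ i : Fin (m + 2),
      (-1 : ℤ) ^ (i : ℕ) • T (fun a => j.succAbove (i.succAbove a)) = 0 := by
  simp only [Finset.smul_sum, smul_smul, ← pow_add]
  rw [← Finset.sum_product', ← Finset.sum_filter_add_sum_filter_not _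
    (fun p : Fin (m + 3) × Fin (m + 2) => (p.2 : ℕ) < p.1)]
  rw [add_eq_zero_iff_eq_neg, ← Finset.sum_neg_distrib]
  refine Finset.sum_bij' (i := fun p hp => (p.2.castSucc, p.1.pred ?_))
    (j := fun p hp => (p.2.succ, p.1.castLT ?_)) ?_ ?_ ?_ ?_ ?_
  · simp at hp
    rintro h
    simp [h] at hp
  · simp at hp
    have := p.2.2
    omega
  · rintro ⟨j, i⟩ hp
    simp at hp ⊢
    omega
  · rintro ⟨j, i⟩ hp
    simp at hp ⊢
    omega
  · rintro ⟨j, i⟩ hp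
    simp
  · rintro ⟨j, i⟩ hp
    simp
  · rintro ⟨j, i⟩ hp
    simp at hp
    have hT : (fun a => j.succAbove (i.succAbove a)) = fun a : Fin (m + 1) =>
        i.castSucc.succAbove ((j.pred (by rintro h; simp [h] at hp)).succAbove a) := by
      funext a
      ext
      simp only [Fin.succAbove, Fin.lt_def]
      split_ifs <;> simp at * <;> omega
    rw [← hT]
    have : (j : ℕ) + i = (i + (j - 1 : ℕ)) + 1 := by omega
    simp [this, pow_succ]

theorem d_d (X : ι → E) (P : Eᵒᵖ ⥤ AddCommGrpCat.{w}) {m : ℕ} (c : Cochain X P m) :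
    d X P (m + 1) (d X P m c) = 0 := by
  funext s
  rw [d_apply]
  have h : ∀ j : Fin (m + 3), pull X P (d X P m c) s j.succAbove =
      ∑ i : Fin (m + 2), (-1 : ℤ) ^ (i : ℕ) • pull X P c s
        (fun a => j.succAbove (i.succAbove a)) := by
    intro j
    rw [pull, d_apply, map_sum]
    refine Finset.sum_congr rfl fun i _ => ?_
    rw [map_zsmul, map_pull]
  simp only [h]
  exact sum_neg_one_pow_succAbove_comp (pull X P c s)

/-- Two cochains agree if their restrictions to the products with one more factor agree: the
projection that forgets a repeated index has a section. -/
theorem cochain_ext_face (X : ι → E) (P : Eᵒᵖ ⥤ AddCommGrpCat.{w}) {m : ℕ} {c c' : Cochain X P m}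
    (h : ∀ (s : Fin (m + 2) → ι) (j : Fin (m + 2)),
      pull X P c s j.succAbove = pull X P c' s j.succAbove) : c = c' := by
  funext s
  -- `ψ` doubles the first index, so omitting position 0 afterwards is the identity; only the face
  -- `j = 0` is needed.
  let ψ : Fin (m + 2) → Fin (m + 1) := Fin.cons 0 id
  have h1 := congrArg (P.map (reindex X s ψ).op).hom (h (fun a => s (ψ a)) 0)
  rw [map_pull, map_pull] at h1
  have h2 : (fun a => ψ (Fin.succAbove 0 a)) = id := by
    funext a
    simp [ψ]
  rw [h2] at h1
  have h3 : reindex X s id = 𝟙 _ := by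
    apply Pi.hom_ext
    intro a
    simp [reindex]
  simpa [pull, h3] using h1

variable {X : ι → E}

/-! ### Maps of Čech complexes and the connecting homomorphism. -/

section MapFamily

variable {P Q : Eᵒᵖ ⥤ AddCommGrpCat.{w}}
  (f : ∀ (m : ℕ) (s : Fin (m + 1) → ι), P.obj (op (inter X s)) →+ Q.obj (op (inter X s)))

/-- Homomorphisms over the products of the members of the family that are compatible with the
face maps. -/
def FaceCompatible : Prop :=
  ∀ (m : ℕ) (s : Fin (m + 2) → ι) (j : Fin (m + 2)) (a),
    f (m + 1) s ((P.map (face X s j).op).hom a) = (Q.map (face X s j).op).hom (f m _ a)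

/-- The map of cochains induced by a family of homomorphisms. -/
noncomputable def mapCochain (m : ℕ) (c : Cochain X P m) : Cochain X Q m := fun s => f m s (c s)

variable {f}

theorem mapCochain_d (hf : FaceCompatible f) {m : ℕ} (c : Cochain X P m) :
    mapCochain f (m + 1) (d X P m c) = d X Q m (mapCochain f m c) := by
  funext s
  simp only [mapCochain, d_apply, map_sum, map_zsmul]
  exact Finset.sum_congr rfl fun j _ => congrArg _ (hf m s j _)

theorem mapCochain_injective (hf : ∀ m s, Function.Injective (f m s)) (m : ℕ) :
    Function.Injective (mapCochain f m) := fun _ _ h => funext fun s => hf m s (congrFun h s)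

theorem mapCochain_sub (m : ℕ) (c c' : Cochain X P m) :
    mapCochain f m (c - c') = mapCochain f m c - mapCochain f m c' :=
  funext fun s => map_sub (f m s) _ _

end MapFamily

section Connecting

variable {P A Q : Eᵒᵖ ⥤ AddCommGrpCat.{w}}
  {f : ∀ (m : ℕ) (s : Fin (m + 1) → ι), P.obj (op (inter X s)) →+ A.obj (op (inter X s))}
  {g : ∀ (m : ℕ) (s : Fin (m + 1) → ι), A.obj (op (inter X s)) →+ Q.obj (op (inter X s))}

/-- The value of the connecting homomorphism is a cocycle. -/
theorem d_eq_zero_of_mapCochain_eq (hf : FaceCompatible f)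
    (hinj : ∀ m s, Function.Injective (f m s)) {m : ℕ} {a : Cochain X A m}
    {c : Cochain X P (m + 1)} (h : mapCochain f (m + 1) c = d X A m a) : d X P (m + 1) c = 0 := by
  apply mapCochain_injective hinj
  rw [mapCochain_d hf, h, d_d]
  funext s
  simp [mapCochain]

/-- The class of the value of the connecting homomorphism depends only on the given class. -/
theorem sub_mem_range_of_mapCochain_eq (hf : FaceCompatible f) (hg : FaceCompatible g)
    (hinj : ∀ m s, Function.Injective (f m s)) (hsurj : ∀ m s, Function.Surjective (g m s))
    (hexact : ∀ m s a, g m s a = 0 → ∃ b, f m s b = a) {m : ℕ}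
    {a a' : Cochain X A (m + 1)} {c c' : Cochain X P (m + 2)}
    (h : mapCochain f (m + 2) c = d X A (m + 1) a)
    (h' : mapCochain f (m + 2) c' = d X A (m + 1) a')
    (hcob : mapCochain g (m + 1) a - mapCochain g (m + 1) a' ∈ (d X Q m).range) :
    c - c' ∈ (d X P (m + 1)).range := by
  obtain ⟨b, hb⟩ := hcob
  -- Lift the primitive `b` to `A`; then `a - a' - d b'` lies in the kernel of `g`, and its preimage
  -- `e` in `P` is a primitive of `c - c'`.
  choose b' hb' using fun s => hsurj m s (b s)
  have hgb : mapCochain g m b' = b := funext hb'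
  have h0 : mapCochain g (m + 1) (a - a' - d X A m b') = 0 := by
    rw [mapCochain_sub, mapCochain_sub, mapCochain_d hg, hgb, hb, sub_self]
  choose e he using fun s => hexact (m + 1) s _ (congrFun h0 s)
  refine ⟨e, mapCochain_injective hinj _ ?_⟩
  have he' : mapCochain f (m + 1) e = a - a' - d X A m b' := funext he
  rw [mapCochain_d hf, he', map_sub, d_d, sub_zero, map_sub, mapCochain_sub, h, h']

end Connecting

end Cech

/-! ### Formal properties of actions, projections and restrictions. -/

namespace TowerData

variable {E : Type u} [Category.{v} E] {J : GrothendieckTopology E}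
  {T : TowerData.{v, u, v', u', w} J}

/-- The order is reversed because the product `f * g` in `Aut x` is `g ≫ f`. -/
theorem aut_add (k : ℕ) {U : E} (x : T.Fib (k + 1) U) (a b : (T.L k).obj.obj (op U)) :
    T.aut k x (a + b) = T.aut k x b ≫ T.aut k x a := by
  simp only [aut, ofAdd_add, map_mul]
  rfl

theorem aut'_add (k : ℕ) {U : E} (x : T.Fib (k + 2) U) (a b : (T.L' k).obj.obj (op U)) :
    T.aut' k x (a + b) = T.aut' k x b ≫ T.aut' k x a := by
  simp only [aut', ofAdd_add, map_mul]
  rfl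

theorem aut_zero (k : ℕ) {U : E} (x : T.Fib (k + 1) U) : T.aut k x 0 = 𝟙 x := by
  simp only [aut, ofAdd_zero, map_one]
  rfl

theorem aut_eqToHom (k : ℕ) {U : E} {x y : T.Fib (k + 1) U} (h : x = y)
    (a : (T.L k).obj.obj (op U)) : T.aut k x a ≫ eqToHom h = eqToHom h ≫ T.aut k y a := by
  subst h
  simp

theorem Admissible.aut_comm {U : E} {k : ℕ} {x y : T.Fib (k + 1) U} {u : x ≅ y}
    (h : T.Admissible (k + 1) u) (a : (T.L k).obj.obj (op U)) :
    T.aut k x a ≫ u.hom = u.hom ≫ T.aut k y a := by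
  cases k with
  | zero => exact h.2 a
  | succ k => exact h.2.2.1 a

/-- Naturality of `p` is an equality of functors; on arrows it becomes an equality up to conjugation
by `eqToHom`. -/
theorem proj_res (T : TowerData.{v, u, v', u', w} J) (k : ℕ) {U V : E} (f : V ⟶ U) :
    T.res (k + 1) f ⋙ T.proj k V = T.proj k U ⋙ T.res k f :=
  congrArg Cat.Hom.toFunctor ((T.p k).naturality f.op)

theorem proj_res_obj (k : ℕ) {U V : E} (f : V ⟶ U) (x : T.Fib (k + 1) U) :
    (T.proj k V).obj ((T.res (k + 1) f).obj x) = (T.res k f).obj ((T.proj k U).obj x) :=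
  Functor.congr_obj (T.proj_res k f) x

theorem proj_res_map (k : ℕ) {U V : E} (f : V ⟶ U) {x y : T.Fib (k + 1) U} (m : x ⟶ y) :
    (T.proj k V).map ((T.res (k + 1) f).map m) = eqToHom (proj_res_obj k f x) ≫
      (T.res k f).map ((T.proj k U).map m) ≫ eqToHom (proj_res_obj k f y).symm :=
  Functor.congr_hom (T.proj_res k f) m

theorem res_map_comp (k : ℕ) {U V W : E} (g : W ⟶ V) (f : V ⟶ U) (h : W ⟶ U)
    (e : g ≫ f = h) {x y : T.Fib k U} (m : x ⟶ y) :
    (T.res k g).map ((T.res k f).map m) = eqToHom (T.res_obj_comp k g f h e x) ≫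
      (T.res k h).map m ≫ eqToHom (T.res_obj_comp k g f h e y).symm := by
  subst e
  have h1 : T.res k (g ≫ f) = T.res k f ⋙ T.res k g :=
    congrArg Cat.Hom.toFunctor ((T.F k).map_comp f.op g.op)
  exact Functor.congr_hom h1.symm m

/-! ### The exact sequence of sections over a connected object. -/

namespace IsAbelianTowerOfTorsors

variable {n : ℕ}

theorem aut_injective (hT : T.IsAbelianTowerOfTorsors n)
    {k : ℕ} (hk : k + 2 ≤ n) {U : E} (x : T.Fib (k + 1) U) :
    Function.Injective (T.aut k x) := fun _ _ h =>
  Multiplicative.ofAdd.injective (hT.act_injective k hk U x (Iso.ext h))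

theorem aut'_injective (hT : T.IsAbelianTowerOfTorsors n)
    {k : ℕ} (hk : k + 3 ≤ n) {U : E} (x : T.Fib (k + 2) U) :
    Function.Injective (T.aut' k x) := fun _ _ h =>
  Multiplicative.ofAdd.injective (hT.act'_injective k hk U x (Iso.ext h))

theorem proj_aut (hT : T.IsAbelianTowerOfTorsors n)
    {k : ℕ} (hk : k + 2 ≤ n) {U : E} (x : T.Fib (k + 1) U)
    (a : (T.L k).obj.obj (op U)) : (T.proj k U).map (T.aut k x a) = 𝟙 _ :=
  (hT.act_range k hk U x _).1 ⟨_, rfl⟩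

theorem exists_aut (hT : T.IsAbelianTowerOfTorsors n)
    {k : ℕ} (hk : k + 2 ≤ n) {U : E} (x : T.Fib (k + 1) U) (f : x ≅ x)
    (h : (T.proj k U).map f.hom = 𝟙 _) : ∃ a, T.aut k x a = f.hom := by
  obtain ⟨a, ha⟩ := (hT.act_range k hk U x f).2 h
  exact ⟨a.toAdd, congrArg Iso.hom ha⟩

theorem proj_proj_aut' (hT : T.IsAbelianTowerOfTorsors n)
    {k : ℕ} (hk : k + 3 ≤ n) {U : E} (x : T.Fib (k + 2) U)
    (a : (T.L' k).obj.obj (op U)) :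
    (T.proj k U).map ((T.proj (k + 1) U).map (T.aut' k x a)) = 𝟙 _ :=
  (hT.act'_range k hk U x _).1 ⟨_, rfl⟩

theorem exists_aut' (hT : T.IsAbelianTowerOfTorsors n)
    {k : ℕ} (hk : k + 3 ≤ n) {U : E} (x : T.Fib (k + 2) U) (f : x ≅ x)
    (h : (T.proj k U).map ((T.proj (k + 1) U).map f.hom) = 𝟙 _) : ∃ a, T.aut' k x a = f.hom := by
  obtain ⟨a, ha⟩ := (hT.act'_range k hk U x f).2 h
  exact ⟨a.toAdd, congrArg Iso.hom ha⟩

/-- Over an object over which the tower is connected, an object of a stage can be chosen over any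
given object of the stage below, as soon as there is one at all. -/
theorem exists_proj_obj_eq (hT : T.IsAbelianTowerOfTorsors n)
    {k : ℕ} (hk : k + 2 ≤ n) {U : E} (hU : T.ConnectedOver n U)
    (w : T.Fib (k + 1) U) (z : T.Fib k U) : ∃ y : T.Fib (k + 1) U, (T.proj k U).obj y = z := by
  have := hT.fibered k hk U
  -- The image of `w` is isomorphic to `z`; the source of a cartesian lift of this isomorphism lies
  -- over `z` exactly.
  obtain ⟨u, -⟩ := hU k (by omega) z ((T.proj k U).obj w)
  obtain ⟨y, φ, hφ⟩ := Functor.IsPreFibered.exists_isCartesian' (p := T.proj k U) u.hom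
  exact ⟨y, IsHomLift.domain_eq (T.proj k U) u.hom φ⟩

/-- The projection of automorphisms over the identity two stages below is surjective. -/
theorem exists_aut'_over (hT : T.IsAbelianTowerOfTorsors n)
    {k : ℕ} (hk : k + 3 ≤ n) {U : E} (hU : T.ConnectedOver n U)
    (x : T.Fib (k + 2) U) (b : (T.L k).obj.obj (op U)) :
    ∃ a, (T.proj (k + 1) U).map (T.aut' k x a) = T.aut k ((T.proj (k + 1) U).obj x) b := by
  have := hT.fibered (k + 1) (by omega) U
  let β : (T.proj (k + 1) U).obj x ≅ (T.proj (k + 1) U).obj x :=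
    T.act k U ((T.proj (k + 1) U).obj x) (Multiplicative.ofAdd b)
  obtain ⟨y, φ, hφ⟩ := Functor.IsPreFibered.exists_isCartesian' (p := T.proj (k + 1) U) (a := x) β.hom
  have hy : (T.proj (k + 1) U).obj y = (T.proj (k + 1) U).obj x :=
    IsHomLift.domain_eq (T.proj (k + 1) U) β.hom φ
  -- The cartesian lift `φ` of `β` starts at some `y` over the image of `x`, not at `x` itself.
  -- Since `x` and `y` have the same image, the admissible `u` projects to the identity, so `u`
  -- followed by `φ` is an automorphism of `x` over `β`.
  obtain ⟨u, hu⟩ := hU (k + 2) (by omega) x y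
  have hφ' : IsIso φ := Functor.IsStronglyCartesian.isIso_of_base_isIso (T.proj (k + 1) U) β.hom φ
  have hf : (T.proj (k + 1) U).map (u ≪≫ asIso φ).hom = T.aut k ((T.proj (k + 1) U).obj x) b := by
    have h1 := IsHomLift.fac' (T.proj (k + 1) U) β.hom φ
    have h2 := hu.2.1 hy.symm
    simp only [Iso.trans_hom, asIso_hom, Functor.map_comp]
    rw [h1, h2]
    simp [β]
  obtain ⟨a, ha⟩ := hT.exists_aut' hk x (u ≪≫ asIso φ) (by rw [hf, hT.proj_aut (by omega)])
  exact ⟨a, by rw [ha, hf]⟩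

/-- Over an object over which the tower is connected and non-empty, the action of `L'` on a stage
projects to the action of `L` on the stage below by a surjective homomorphism. -/
theorem exists_quotientMap (hT : T.IsAbelianTowerOfTorsors n)
    {k : ℕ} (hk : k + 3 ≤ n) {U : E} (hU : T.ConnectedOver n U)
    (hne : Nonempty (T.Fib (k + 2) U)) :
    ∃ q : (T.L' k).obj.obj (op U) →+ (T.L k).obj.obj (op U),
      (∀ x a, (T.proj (k + 1) U).map (T.aut' k x a) = T.aut k ((T.proj (k + 1) U).obj x) (q a)) ∧
      Function.Surjective q := by
  obtain ⟨x₀⟩ := hne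
  have hk' : k + 2 ≤ n := by omega
  -- The homomorphism is read off at the one object `x₀` and carried to the others by admissible
  -- isomorphisms.
  choose q hq using fun a => hT.exists_aut hk' ((T.proj (k + 1) U).obj x₀)
    ((T.proj (k + 1) U).mapIso (T.act' k U x₀ (Multiplicative.ofAdd a)))
    (hT.proj_proj_aut' hk x₀ a)
  have hinj := hT.aut_injective hk' ((T.proj (k + 1) U).obj x₀)
  refine ⟨AddMonoidHom.mk' q fun a b => hinj ?_, fun x a => ?_, fun b => ?_⟩
  · have h1 := hq (a + b)
    have h2 := congrArg (T.proj (k + 1) U).map (aut'_add k x₀ a b)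
    rw [Functor.map_comp] at h2
    rw [aut_add, hq, hq, hq]
    exact h2
  -- `u` intertwines the actions of `L'` on `x₀` and `x`, and its projection intertwines those of
  -- `L` on their images; hence `q` serves for `x` too.
  · obtain ⟨u, hu⟩ := hU (k + 2) (by omega) x₀ x
    have h1 := congrArg (T.proj (k + 1) U).map (hu.2.2.2 a)
    rw [Functor.map_comp, Functor.map_comp] at h1
    have h2 := hu.1.aut_comm (q a)
    rw [hq] at h2
    rw [← cancel_epi ((T.proj (k + 1) U).map u.hom)]
    exact h1.symm.trans h2
  · obtain ⟨a, ha⟩ := hT.exists_aut'_over hk hU x₀ b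
    exact ⟨a, hinj ((hq a).trans ha)⟩

/-- Over an object over which the tower is connected and non-empty, the action of `L` on a stage is
the restriction of the action of `L'` along an injective homomorphism. -/
theorem exists_subobjectMap (hT : T.IsAbelianTowerOfTorsors n)
    {k : ℕ} (hk : k + 3 ≤ n) {U : E} (hU : T.ConnectedOver n U)
    (hne : Nonempty (T.Fib (k + 2) U)) :
    ∃ i : (T.L (k + 1)).obj.obj (op U) →+ (T.L' k).obj.obj (op U),
      (∀ x c, T.aut (k + 1) x c = T.aut' k x (i c)) ∧ Function.Injective i := by
  obtain ⟨x₀⟩ := hne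
  have hk' : k + 1 + 2 ≤ n := hk
  choose i hi using fun c => hT.exists_aut' hk x₀
    (T.act (k + 1) U x₀ (Multiplicative.ofAdd c))
    ((congrArg (T.proj k U).map (hT.proj_aut hk' x₀ c)).trans (CategoryTheory.Functor.map_id _ _))
  have hinj := hT.aut'_injective hk x₀
  refine ⟨AddMonoidHom.mk' i fun a b => hinj ?_, fun x a => ?_, fun a b h => ?_⟩
  · rw [aut'_add, hi, hi, hi]
    exact aut_add (k + 1) x₀ a b
  · obtain ⟨u, hu⟩ := hU (k + 2) (by omega) x₀ x
    rw [← cancel_epi u.hom]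
    exact (hu.2.2.1 a).symm.trans ((congrArg (· ≫ u.hom) (hi a).symm).trans (hu.2.2.2 (i a)))
  · refine hT.aut_injective hk' x₀ ((hi a).symm.trans (Eq.trans ?_ (hi b)))
    exact congrArg (T.aut' k x₀) h

end IsAbelianTowerOfTorsors

/-! ### The exact sequences over the products of a contractible covering. -/

section Cover

variable [HasFiniteProducts E] {ι : Type t} {X : ι → E} {n : ℕ}

theorem IsContractibleCover.nonempty_inter (hX : T.IsContractibleCover X n) {k : ℕ} (hk : k < n)
    {m : ℕ} (s : Fin (m + 1) → ι) : Nonempty (T.Fib k (Cech.inter X s)) :=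
  (hX.nonempty (s 0) k hk).map (T.res k (Cech.pr X s 0)).obj

/-- The exact sequences of sections of `L_{k+3}`, `L'_{k+3}` and `L_{k+2}` over the products of the
members of a contractible covering. -/
structure SectionSequence (T : TowerData.{v, u, v', u', w} J) (X : ι → E) (k : ℕ) where
  sub : ∀ (m : ℕ) (s : Fin (m + 1) → ι),
    (T.L (k + 1)).obj.obj (op (Cech.inter X s)) →+ (T.L' k).obj.obj (op (Cech.inter X s))
  quot : ∀ (m : ℕ) (s : Fin (m + 1) → ι),
    (T.L' k).obj.obj (op (Cech.inter X s)) →+ (T.L k).obj.obj (op (Cech.inter X s))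
  aut_eq : ∀ m s x c, T.aut (k + 1) x c = T.aut' k x (sub m s c)
  proj_aut' : ∀ m s x a, (T.proj (k + 1) (Cech.inter X s)).map (T.aut' k x a) =
    T.aut k ((T.proj (k + 1) (Cech.inter X s)).obj x) (quot m s a)
  injective : ∀ m s, Function.Injective (sub m s)
  surjective : ∀ m s, Function.Surjective (quot m s)

theorem IsContractibleCover.nonempty_sectionSequence (hX : T.IsContractibleCover X n)
    (hT : T.IsAbelianTowerOfTorsors n) {k : ℕ} (hk : k + 3 ≤ n) :
    Nonempty (T.SectionSequence X k) := by
  have hne : ∀ (m : ℕ) (s : Fin (m + 1) → ι), Nonempty (T.Fib (k + 2) (Cech.inter X s)) :=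
    fun m s => hX.nonempty_inter (by omega) s
  choose i hi hi' using fun m s => hT.exists_subobjectMap hk (hX.connected m s) (hne m s)
  choose q hq hq' using fun m s => hT.exists_quotientMap hk (hX.connected m s) (hne m s)
  exact ⟨⟨i, q, hi, hq, hi', hq'⟩⟩

namespace SectionSequence

variable {k : ℕ} (S : T.SectionSequence X k)

/-- Exactness in the middle: when `quot` kills `a`, the automorphism given by `a` lies over an
identity one stage below, so it comes from `L_{k+3}`. -/
theorem exists_sub_eq (hT : T.IsAbelianTowerOfTorsors n)
    (hX : T.IsContractibleCover X n) (hk : k + 3 ≤ n) (m : ℕ) (s : Fin (m + 1) → ι) (a)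
    (h : S.quot m s a = 0) :
    ∃ c, S.sub m s c = a := by
  obtain ⟨x⟩ := hX.nonempty_inter (k := k + 2) (by omega) s
  obtain ⟨c, hc⟩ := hT.exists_aut (k := k + 1) hk x (T.act' k _ x (Multiplicative.ofAdd a))
    (by have := S.proj_aut' m s x a
        rw [h, aut_zero] at this
        exact this)
  exact ⟨c, hT.aut'_injective hk x ((S.aut_eq m s x c).symm.trans hc)⟩

/-- Both actions commute with restriction, so the two sections of `L'` act alike on a restricted
object, where the action is faithful. -/
theorem faceCompatible_sub (hT : T.IsAbelianTowerOfTorsors n)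
    (hX : T.IsContractibleCover X n) (hk : k + 3 ≤ n) :
    Cech.FaceCompatible (P := (T.L (k + 1)).obj) (Q := (T.L' k).obj) S.sub := by
  intro m s j a
  obtain ⟨x⟩ := hX.nonempty_inter (k := k + 2) (by omega) fun a => s (j.succAbove a)
  refine hT.aut'_injective hk ((T.res (k + 2) (Cech.face X s j)).obj x) ?_
  rw [hT.act'_res k hk, ← S.aut_eq, ← S.aut_eq]
  exact hT.act_res (k + 1) hk _ _ _

theorem faceCompatible_quot (hT : T.IsAbelianTowerOfTorsors n)
    (hX : T.IsContractibleCover X n) (hk : k + 3 ≤ n) :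
    Cech.FaceCompatible (P := (T.L' k).obj) (Q := (T.L k).obj) S.quot := by
  intro m s j a
  have hk' : k + 2 ≤ n := by omega
  obtain ⟨x⟩ := hX.nonempty_inter (k := k + 2) (by omega) fun a => s (j.succAbove a)
  refine hT.aut_injective hk'
    ((T.proj (k + 1) _).obj ((T.res (k + 2) (Cech.face X s j)).obj x)) ?_
  rw [← S.proj_aut', hT.act'_res k hk, proj_res_map, S.proj_aut', ← hT.act_res k hk',
    ← Category.assoc, ← aut_eqToHom k (proj_res_obj (k + 1) (Cech.face X s j) x)]
  simp

end SectionSequence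

end Cover

/-! ### The degree 2 cocycle of the gerbe. -/

section Gerbe

variable {n : ℕ}

/-- The lowest stage has only identities, so every arrow of `F_2` over `U` lies over one, and the
action of `L_2` is central. -/
theorem IsAbelianTowerOfTorsors.aut_zero_comm (hT : T.IsAbelianTowerOfTorsors n) (hn : 2 ≤ n)
    {U : E} {x y : T.Fib 1 U} (f : x ⟶ y) (a : (T.L 0).obj.obj (op U)) :
    T.aut 0 x a ≫ f = f ≫ T.aut 0 y a := by
  obtain ⟨hU⟩ := hT.base_obj U
  have := hT.base_hom U
  have hxy : (T.proj 0 U).obj y = (T.proj 0 U).obj x := Subsingleton.elim _ _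
  exact hT.act_natural 0 hn U ((T.proj 0 U).obj x) f
    (IsHomLift.of_fac _ _ _ rfl hxy (Subsingleton.elim _ _)) a

theorem IsAbelianTowerOfTorsors.exists_aut_zero (hT : T.IsAbelianTowerOfTorsors n) (hn : 2 ≤ n)
    {U : E} {x : T.Fib 1 U} (f : x ≅ x) : ∃ a, T.act 0 U x (Multiplicative.ofAdd a) = f := by
  have := hT.base_hom U
  obtain ⟨a, ha⟩ := hT.exists_aut hn x f (Subsingleton.elim _ _)
  exact ⟨a, Iso.ext ha⟩

theorem IsAbelianTowerOfTorsors.eq_of_aut_comp_eq (hT : T.IsAbelianTowerOfTorsors n) (hn : 2 ≤ n)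
    {U : E} {x y : T.Fib 1 U} (f : x ≅ y) {a b : (T.L 0).obj.obj (op U)}
    (h : T.aut 0 x a ≫ f.hom = T.aut 0 x b ≫ f.hom) : a = b :=
  hT.aut_injective hn x ((cancel_mono f.hom).1 h)

variable [HasFiniteProducts E] {ι : Type t} {X : ι → E}

/-- The restriction of `g_{s a, s b}` to the product `X_s` of any number of factors. -/
noncomputable def transition (x : ∀ i, T.Fib 1 (X i))
    (g : ∀ i j, (T.res 1 (Cech.snd X i j)).obj (x j) ≅ (T.res 1 (Cech.fst X i j)).obj (x i))
    {m : ℕ} (s : Fin m → ι) (a b : Fin m) :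
    (T.res 1 (Cech.pr X s b)).obj (x (s b)) ≅ (T.res 1 (Cech.pr X s a)).obj (x (s a)) :=
  eqToIso (T.res_obj_comp 1 _ _ _ (Cech.pairMap_snd X s a b) (x (s b))).symm ≪≫
    (T.res 1 (Cech.pairMap X s a b)).mapIso (g (s a) (s b)) ≪≫
    eqToIso (T.res_obj_comp 1 _ _ _ (Cech.pairMap_fst X s a b) (x (s a)))

theorem res_transition (x : ∀ i, T.Fib 1 (X i))
    (g : ∀ i j, (T.res 1 (Cech.snd X i j)).obj (x j) ≅ (T.res 1 (Cech.fst X i j)).obj (x i))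
    {l m : ℕ} (s : Fin m → ι) (φ : Fin l → Fin m) (a b : Fin l) :
    (T.res 1 (Cech.reindex X s φ)).map (T.transition x g (fun c => s (φ c)) a b).hom =
      eqToHom (T.res_obj_comp 1 _ _ _ (Cech.reindex_pr X s φ b) (x (s (φ b)))) ≫
      (T.transition x g s (φ a) (φ b)).hom ≫
      eqToHom (T.res_obj_comp 1 _ _ _ (Cech.reindex_pr X s φ a) (x (s (φ a)))).symm := by
  have h := res_map_comp (T := T) 1 _ _ _ (Cech.reindex_pairMap X s φ a b) (g (s (φ a)) (s (φ b))).hom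
  simp only [transition, Iso.trans_hom, eqToIso.hom, Functor.mapIso_hom, Functor.map_comp,
    eqToHom_map]
  erw [h]
  simp

variable {x x' : ∀ i, T.Fib 1 (X i)}
  {g : ∀ i j, (T.res 1 (Cech.snd X i j)).obj (x j) ≅ (T.res 1 (Cech.fst X i j)).obj (x i)}
  {g' : ∀ i j, (T.res 1 (Cech.snd X i j)).obj (x' j) ≅ (T.res 1 (Cech.fst X i j)).obj (x' i)}
  {c c' : Cech.Cochain X (T.L 0).obj 2}

/-- The defining relation of `c`, freed of inverses and restricted to products with any number of
factors, so that several instances can be compared over one product. -/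
theorem aut_pull_giraud (hT : T.IsAbelianTowerOfTorsors n) (hn : 2 ≤ n)
    (hc : ∀ s, T.act 0 _ ((T.res 1 (Cech.pr X s 2)).obj (x (s 2)))
      (Multiplicative.ofAdd (c s)) = T.giraud x g s)
    {m : ℕ} (s : Fin m → ι) (φ : Fin 3 → Fin m) :
    T.aut 0 ((T.res 1 (Cech.pr X s (φ 2))).obj (x (s (φ 2)))) (Cech.pull X (T.L 0).obj c s φ) ≫
        (T.transition x g s (φ 0) (φ 2)).hom =
      (T.transition x g s (φ 1) (φ 2)).hom ≫ (T.transition x g s (φ 0) (φ 1)).hom := by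
  set σ : Fin 3 → ι := fun a => s (φ a)
  have h0 : T.aut 0 ((T.res 1 (Cech.pr X σ 2)).obj (x (σ 2))) (c σ) ≫
      (T.transition x g σ 0 2).hom =
      (T.transition x g σ 1 2).hom ≫ (T.transition x g σ 0 1).hom := by
    -- `gRes` is by definition `transition` with three factors.
    have h1 : T.aut 0 ((T.res 1 (Cech.pr X σ 2)).obj (x (σ 2))) (c σ) =
        (T.transition x g σ 1 2).hom ≫ (T.transition x g σ 0 1).hom ≫
          (T.transition x g σ 0 2).inv := congrArg Iso.hom (hc σ)
    rw [h1]
    simp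
  have h2 := congrArg (T.res 1 (Cech.reindex X s φ)).map h0
  rw [Functor.map_comp, Functor.map_comp, res_transition, res_transition, res_transition,
    ← hT.act_res 0 hn, ← Category.assoc, aut_eqToHom 0 (T.res_obj_comp 1 _ _ _
      (Cech.reindex_pr X s φ 2) (x (s (φ 2))))] at h2
  refine (cancel_mono (eqToHom
    (T.res_obj_comp 1 _ _ _ (Cech.reindex_pr X s φ 0) (x (s (φ 0)))).symm)).1 ?_
  simp only [Category.assoc, eqToHom_trans_assoc, eqToHom_refl, Category.id_comp,
    cancel_epi] at h2 ⊢
  exact h2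

/-- On a fourfold product the composite `g_{01} g_{12} g_{23}` can be contracted to `g_{03}` in two
ways, at the cost of `c0 + c2` or of `c1 + c3`. The section `c3` acts on the object of index 2 and
is moved past `g_{23}` by centrality. -/
theorem d_eq_zero_of_giraud (hT : T.IsAbelianTowerOfTorsors n) (hn : 2 ≤ n)
    (hc : ∀ s, T.act 0 _ ((T.res 1 (Cech.pr X s 2)).obj (x (s 2)))
      (Multiplicative.ofAdd (c s)) = T.giraud x g s) :
    Cech.d X (T.L 0).obj 2 c = 0 := by
  funext s
  have H := aut_pull_giraud hT hn hc s
  have h0 := H (Fin.succAbove 0)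
  have h1 := H (Fin.succAbove 1)
  have h2 := H (Fin.succAbove 2)
  have h3 := H (Fin.succAbove 3)
  rw [Cech.d_apply]
  refine (Fin.sum_univ_four _).trans ?_
  generalize Cech.pull X (T.L 0).obj c s (Fin.succAbove 0) = c0 at *
  generalize Cech.pull X (T.L 0).obj c s (Fin.succAbove 1) = c1 at *
  generalize Cech.pull X (T.L 0).obj c s (Fin.succAbove 2) = c2 at *
  generalize Cech.pull X (T.L 0).obj c s (Fin.succAbove 3) = c3 at *
  let y : Fin 4 → T.Fib 1 (Cech.inter X s) := fun a => (T.res 1 (Cech.pr X s a)).obj (x (s a))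
  let G : ∀ a b, y b ≅ y a := T.transition x g s
  replace h0 : T.aut 0 (y 3) c0 ≫ (G 1 3).hom = (G 2 3).hom ≫ (G 1 2).hom := h0
  replace h1 : T.aut 0 (y 3) c1 ≫ (G 0 3).hom = (G 2 3).hom ≫ (G 0 2).hom := h1
  replace h2 : T.aut 0 (y 3) c2 ≫ (G 0 3).hom = (G 1 3).hom ≫ (G 0 1).hom := h2
  replace h3 : T.aut 0 (y 2) c3 ≫ (G 0 2).hom = (G 1 2).hom ≫ (G 0 1).hom := h3
  have key : c2 + c0 = c1 + c3 := by
    refine hT.eq_of_aut_comp_eq hn (G 0 3) ?_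
    calc T.aut 0 (y 3) (c2 + c0) ≫ (G 0 3).hom
        = T.aut 0 (y 3) c0 ≫ T.aut 0 (y 3) c2 ≫ (G 0 3).hom := by
          rw [aut_add, Category.assoc]
      _ = (T.aut 0 (y 3) c0 ≫ (G 1 3).hom) ≫ (G 0 1).hom := by rw [h2, Category.assoc]
      _ = (G 2 3).hom ≫ T.aut 0 (y 2) c3 ≫ (G 0 2).hom := by rw [h0, h3, Category.assoc]
      _ = (T.aut 0 (y 3) c3 ≫ (G 2 3).hom) ≫ (G 0 2).hom := by
          rw [hT.aut_zero_comm hn (G 2 3).hom, Category.assoc]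
      _ = T.aut 0 (y 3) c3 ≫ T.aut 0 (y 3) c1 ≫ (G 0 3).hom := by rw [h1, Category.assoc]
      _ = T.aut 0 (y 3) (c1 + c3) ≫ (G 0 3).hom := by rw [aut_add, Category.assoc]
  simp only [Fin.val_zero, pow_zero, one_smul, Fin.val_one, pow_one, neg_smul, Fin.val_two,
    Pi.zero_apply, show ((3 : Fin 4) : ℕ) = 3 from rfl, even_two, Even.neg_pow, one_pow,
    show (-1 : ℤ) ^ 3 = -1 by norm_num]
  rw [show c0 + -c1 + c2 + -c3 = (c2 + c0) - (c1 + c3) by abel, key, sub_self]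

/-- The primitive `e` measures how far the isomorphisms `u` are from commuting with `g` and `g'`.
Going round the prism with faces the triangles of `g` and of `g'` gives `c' - c = d e`. -/
theorem sub_mem_range_of_giraud (hT : T.IsAbelianTowerOfTorsors n) (hn : 2 ≤ n)
    (u : ∀ i, x i ≅ x' i)
    (hc : ∀ s, T.act 0 _ ((T.res 1 (Cech.pr X s 2)).obj (x (s 2)))
      (Multiplicative.ofAdd (c s)) = T.giraud x g s)
    (hc' : ∀ s, T.act 0 _ ((T.res 1 (Cech.pr X s 2)).obj (x' (s 2)))
      (Multiplicative.ofAdd (c' s)) = T.giraud x' g' s) :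
    c' - c ∈ (Cech.d X (T.L 0).obj 1).range := by
  let v : ∀ {m : ℕ} (s : Fin m → ι) (a : Fin m), (T.res 1 (Cech.pr X s a)).obj (x (s a)) ≅
    (T.res 1 (Cech.pr X s a)).obj (x' (s a)) := fun s a => (T.res 1 (Cech.pr X s a)).mapIso (u (s a))
  have hv : ∀ {l m : ℕ} (s : Fin m → ι) (φ : Fin l → Fin m) (a : Fin l),
      (T.res 1 (Cech.reindex X s φ)).map (v (fun b => s (φ b)) a).hom =
      eqToHom (T.res_obj_comp 1 _ _ _ (Cech.reindex_pr X s φ a) (x (s (φ a)))) ≫ (v s (φ a)).hom ≫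
      eqToHom (T.res_obj_comp 1 _ _ _ (Cech.reindex_pr X s φ a) (x' (s (φ a)))).symm :=
    fun s φ a => res_map_comp 1 _ _ _ (Cech.reindex_pr X s φ a) (u (s (φ a))).hom
  choose e he using fun s : Fin 2 → ι => hT.exists_aut_zero hn
    (v s 1 ≪≫ T.transition x' g' s 0 1 ≪≫ (v s 0).symm ≪≫ (T.transition x g s 0 1).symm)
  have He : ∀ {m : ℕ} (s : Fin m → ι) (φ : Fin 2 → Fin m),
      T.aut 0 ((T.res 1 (Cech.pr X s (φ 1))).obj (x (s (φ 1)))) (Cech.pull X (T.L 0).obj e s φ) ≫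
        (T.transition x g s (φ 0) (φ 1)).hom ≫ (v s (φ 0)).hom =
      (v s (φ 1)).hom ≫ (T.transition x' g' s (φ 0) (φ 1)).hom := by
    intro m s φ
    set σ : Fin 2 → ι := fun a => s (φ a)
    have h0 : T.aut 0 ((T.res 1 (Cech.pr X σ 1)).obj (x (σ 1))) (e σ) ≫
        (T.transition x g σ 0 1).hom ≫ (v σ 0).hom =
        (v σ 1).hom ≫ (T.transition x' g' σ 0 1).hom := by
      rw [aut, he]
      simp
    have h2 := congrArg (T.res 1 (Cech.reindex X s φ)).map h0
    rw [Functor.map_comp, Functor.map_comp, Functor.map_comp, res_transition, res_transition,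
      hv, hv, ← hT.act_res 0 hn, Category.assoc, ← Category.assoc,
      aut_eqToHom 0 (T.res_obj_comp 1 _ _ _ (Cech.reindex_pr X s φ 1) (x (s (φ 1))))] at h2
    refine (cancel_mono (eqToHom
      (T.res_obj_comp 1 _ _ _ (Cech.reindex_pr X s φ 0) (x' (s (φ 0)))).symm)).1 ?_
    simp only [Category.assoc, eqToHom_trans_assoc, eqToHom_refl, Category.id_comp,
      cancel_epi] at h2 ⊢
    exact h2
  refine ⟨e, ?_⟩
  funext s
  have h0 := He s (Fin.succAbove 0)
  have h1 := He s (Fin.succAbove 1)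
  have h2 := He s (Fin.succAbove 2)
  have h3 := aut_pull_giraud hT hn hc s id
  have h4 := aut_pull_giraud hT hn hc' s id
  have hid : Cech.reindex X s id = 𝟙 _ := by
    apply Pi.hom_ext
    intro a
    simp [Cech.reindex]
  have hp : Cech.pull X (T.L 0).obj c s id = c s := by simp [Cech.pull, hid]
  have hp' : Cech.pull X (T.L 0).obj c' s id = c' s := by simp [Cech.pull, hid]
  rw [hp] at h3
  rw [hp'] at h4
  rw [Cech.d_apply, Pi.sub_apply]
  refine (Fin.sum_univ_three _).trans ?_
  generalize Cech.pull X (T.L 0).obj e s (Fin.succAbove 0) = e0 at *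
  generalize Cech.pull X (T.L 0).obj e s (Fin.succAbove 1) = e1 at *
  generalize Cech.pull X (T.L 0).obj e s (Fin.succAbove 2) = e2 at *
  generalize c s = b at *
  generalize c' s = b' at *
  let y : Fin 3 → T.Fib 1 (Cech.inter X s) := fun a => (T.res 1 (Cech.pr X s a)).obj (x (s a))
  let y' : Fin 3 → T.Fib 1 (Cech.inter X s) := fun a => (T.res 1 (Cech.pr X s a)).obj (x' (s a))
  let G : ∀ a b, y b ≅ y a := T.transition x g s
  let G' : ∀ a b, y' b ≅ y' a := T.transition x' g' s
  let r : ∀ a, y a ≅ y' a := v s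
  replace h0 : T.aut 0 (y 2) e0 ≫ (G 1 2).hom ≫ (r 1).hom = (r 2).hom ≫ (G' 1 2).hom := h0
  replace h1 : T.aut 0 (y 2) e1 ≫ (G 0 2).hom ≫ (r 0).hom = (r 2).hom ≫ (G' 0 2).hom := h1
  replace h2 : T.aut 0 (y 1) e2 ≫ (G 0 1).hom ≫ (r 0).hom = (r 1).hom ≫ (G' 0 1).hom := h2
  replace h3 : T.aut 0 (y 2) b ≫ (G 0 2).hom = (G 1 2).hom ≫ (G 0 1).hom := h3
  replace h4 : T.aut 0 (y' 2) b' ≫ (G' 0 2).hom = (G' 1 2).hom ≫ (G' 0 1).hom := h4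
  have key : e1 + b' = b + e2 + e0 := by
    refine hT.eq_of_aut_comp_eq hn (G 0 2 ≪≫ r 0) ?_
    calc T.aut 0 (y 2) (e1 + b') ≫ (G 0 2).hom ≫ (r 0).hom
        = T.aut 0 (y 2) b' ≫ T.aut 0 (y 2) e1 ≫ (G 0 2).hom ≫ (r 0).hom := by
          rw [aut_add, Category.assoc]
      _ = (T.aut 0 (y 2) b' ≫ (r 2).hom) ≫ (G' 0 2).hom := by rw [h1, Category.assoc]
      _ = (r 2).hom ≫ (G' 1 2).hom ≫ (G' 0 1).hom := by
          rw [hT.aut_zero_comm hn (r 2).hom, Category.assoc, h4]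
      _ = T.aut 0 (y 2) e0 ≫ (G 1 2).hom ≫ (r 1).hom ≫ (G' 0 1).hom := by
          rw [← Category.assoc, ← h0]
          simp only [Category.assoc]
      _ = T.aut 0 (y 2) e0 ≫ ((G 1 2).hom ≫ T.aut 0 (y 1) e2) ≫ (G 0 1).hom ≫ (r 0).hom := by
          rw [← h2, Category.assoc]
      _ = T.aut 0 (y 2) e0 ≫ T.aut 0 (y 2) e2 ≫ ((G 1 2).hom ≫ (G 0 1).hom) ≫ (r 0).hom := by
          rw [← hT.aut_zero_comm hn]
          simp only [Category.assoc]
      _ = T.aut 0 (y 2) (b + e2 + e0) ≫ (G 0 2).hom ≫ (r 0).hom := by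
          rw [← h3, aut_add, aut_add]
          simp only [Category.assoc]
  simp only [Fin.val_zero, pow_zero, one_smul, Fin.val_one, pow_one, neg_smul, Fin.val_two,
    even_two, Even.neg_pow, one_pow]
  rw [eq_sub_iff_add_eq, show e0 + -e1 + e2 + b = (b + e2 + e0) - e1 by abel, ← key]
  abel

/-- Connectedness is known over the one-factor product, which is only isomorphic to `X i`; the
isomorphism is transported along the section `r` of the projection. -/
theorem IsContractibleCover.nonempty_iso (hX : T.IsContractibleCover X n) {k : ℕ} (hk : k < n)
    (i : ι) (x x' : T.Fib k (X i)) : Nonempty (x ≅ x') := by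
  obtain ⟨u, -⟩ := hX.connected 0 (fun _ => i) k hk ((T.res k (Cech.pr X (fun _ => i) 0)).obj x)
    ((T.res k (Cech.pr X (fun _ => i) 0)).obj x')
  let r : X i ⟶ Cech.inter X (fun _ : Fin 1 => i) := Pi.lift fun _ => 𝟙 _
  have hr : r ≫ Cech.pr X (fun _ => i) 0 = 𝟙 _ := Pi.lift_π _ _
  have hx : ∀ z : T.Fib k (X i),
      (T.res k r).obj ((T.res k (Cech.pr X (fun _ => i) 0)).obj z) = z := by
    intro z
    rw [T.res_obj_comp k r _ _ hr]
    simp [res]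
  exact ⟨eqToIso (hx x).symm ≪≫ (T.res k r).mapIso u ≪≫ eqToIso (hx x')⟩

theorem exists_isClassifying_zero (hT : T.IsAbelianTowerOfTorsors n) (hn : 2 ≤ n)
    (hX : T.IsContractibleCover X n) :
    ∃ x c, T.IsClassifying X 0 x c := by
  have x : ∀ i, T.Fib 1 (X i) := fun i => (hX.nonempty i 1 (by omega)).some
  choose g _ using fun i j => hX.connected 1 ![i, j] 1 (by omega)
    ((T.res 1 (Cech.snd X i j)).obj (x j)) ((T.res 1 (Cech.fst X i j)).obj (x i))
  choose c hc using fun s => hT.exists_aut_zero hn (T.giraud x g s)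
  exact ⟨_, _, .base x g c hc⟩

end Gerbe

/-! ### The inductive step and the conclusion. -/

section Step

variable [HasFiniteProducts E] {ι : Type t} {X : ι → E} {n : ℕ}

theorem IsClassifying.exists_giraud {x c} (h : T.IsClassifying X 0 x c) :
    ∃ (z : ∀ i, T.Fib 1 (X i))
      (g : ∀ i j, (T.res 1 (Cech.snd X i j)).obj (z j) ≅ (T.res 1 (Cech.fst X i j)).obj (z i)),
      ∀ s, T.act 0 _ ((T.res 1 (Cech.pr X s 2)).obj (z (s 2))) (Multiplicative.ofAdd (c s)) =
        T.giraud z g s := by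
  cases h with
  | base z g c hc => exact ⟨z, g, hc⟩

/-- A step of the construction of the classifying cocycles is an application of the connecting
homomorphism of the exact sequence of cochains. -/
theorem IsClassifying.exists_connecting (hT : T.IsAbelianTowerOfTorsors n)
    (hX : T.IsContractibleCover X n) {k : ℕ} (hk : k + 3 ≤ n) (S : T.SectionSequence X k) {y c'}
    (h : T.IsClassifying X (k + 1) y c') :
    ∃ x c a, T.IsClassifying X k x c ∧ Cech.mapCochain (P := (T.L' k).obj) (Q := (T.L k).obj)
        S.quot (k + 2) a = c ∧
      Cech.mapCochain (P := (T.L (k + 1)).obj) (Q := (T.L' k).obj) S.sub (k + 3) c' =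
        Cech.d X (T.L' k).obj (k + 2) a := by
  cases h with
  | step _ x c h y hy lift hlift c' hc' =>
    refine ⟨x, c, lift, h, ?_, ?_⟩
    -- The lifting condition is stated on the objects `y s`, hence only after restriction to
    -- products with one more factor; `cochain_ext_face` descends it.
    · refine Cech.cochain_ext_face X (T.L k).obj fun s j =>
        hT.aut_injective (by omega) ((T.proj (k + 1) _).obj (y s)) (Eq.trans ?_ (hlift s j))
      rw [S.proj_aut', S.faceCompatible_quot hT hX hk]
      rfl
    · funext s
      exact hT.aut'_injective hk (y s) ((S.aut_eq _ s (y s) (c' s)).symm.trans (hc' s))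

/-- The hypothesis that `c` is a cocycle is what puts the alternating sum of the lifts in the kernel
of `quot`, hence in the image of `L_{k+3}`. -/
theorem exists_isClassifying_succ (hT : T.IsAbelianTowerOfTorsors n)
    (hX : T.IsContractibleCover X n) {k : ℕ} (hk : k + 3 ≤ n) (S : T.SectionSequence X k) {x c}
    (h : T.IsClassifying X k x c) (hd : Cech.d X (T.L k).obj (k + 2) c = 0) :
    ∃ y c', T.IsClassifying X (k + 1) y c' := by
  have hg := S.faceCompatible_quot hT hX hk
  choose lift hlift using fun s => S.surjective (k + 2) s (c s)
  have hlift' : Cech.mapCochain (P := (T.L' k).obj) (Q := (T.L k).obj) S.quot (k + 2) lift = c :=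
    funext hlift
  choose y hy using fun s : Fin (k + 3 + 1) → ι => hT.exists_proj_obj_eq (k := k + 1) hk
    (hX.connected _ s) (hX.nonempty_inter (k := k + 2) (by omega) s).some
    ((T.res (k + 1) (Cech.face X s (Fin.last _))).obj (x fun a => s ((Fin.last _).succAbove a)))
  have h0 : Cech.mapCochain (P := (T.L' k).obj) (Q := (T.L k).obj) S.quot (k + 3)
      (Cech.d X (T.L' k).obj (k + 2) lift) = 0 := by
    rw [Cech.mapCochain_d hg, hlift', hd]
  choose c' hc' using fun s => S.exists_sub_eq hT hX hk (k + 3) s _ (congrFun h0 s)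
  refine ⟨y, c', .step k x c h y hy lift (fun s j => ?_) c' fun s => ?_⟩
  · rw [S.proj_aut', hg, hlift]
  · rw [S.aut_eq (k + 3), hc']
    rfl

/-- Classifying cochains exist, are cocycles, and are unique up to coboundaries. -/
theorem isClassifying_exists_cocycle_unique (hT : T.IsAbelianTowerOfTorsors n)
    (hX : T.IsContractibleCover X n) (k : ℕ) (hk : k + 2 ≤ n) :
    (∃ x c, T.IsClassifying X k x c) ∧
    (∀ x c, T.IsClassifying X k x c → Cech.d X (T.L k).obj (k + 2) c = 0) ∧
    ∀ x c x' c', T.IsClassifying X k x c → T.IsClassifying X k x' c' →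
      c - c' ∈ (Cech.d X (T.L k).obj (k + 1)).range := by
  -- The assertions are proved together: existence in the next degree needs the cocycle property in
  -- this one, and uniqueness needs uniqueness.
  induction k with
  | zero =>
    refine ⟨exists_isClassifying_zero hT hk hX, fun x c h => ?_, fun x c x' c' h h' => ?_⟩
    · obtain ⟨z, g, hc⟩ := h.exists_giraud
      exact d_eq_zero_of_giraud hT hk hc
    · obtain ⟨z, g, hc⟩ := h.exists_giraud
      obtain ⟨z', g', hc'⟩ := h'.exists_giraud
      -- This lemma gives the second cochain minus the first, so the two sets of data are exchanged.
      exact sub_mem_range_of_giraud hT hk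
        (fun i => (hX.nonempty_iso (k := 1) (by omega) i (z' i) (z i)).some) hc' hc
  | succ k ih =>
    obtain ⟨⟨x, c, h⟩, hd, hind⟩ := ih (by omega)
    obtain ⟨S⟩ := hX.nonempty_sectionSequence hT hk
    have hf := S.faceCompatible_sub hT hX hk
    have hg := S.faceCompatible_quot hT hX hk
    refine ⟨exists_isClassifying_succ hT hX hk S h (hd _ _ h), fun y c h => ?_,
      fun y c y' c' h h' => ?_⟩
    · obtain ⟨-, -, a, -, -, ha⟩ := h.exists_connecting hT hX hk S
      exact Cech.d_eq_zero_of_mapCochain_eq hf S.injective ha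
    · obtain ⟨x₁, c₁, a, h₁, hq, ha⟩ := h.exists_connecting hT hX hk S
      obtain ⟨x₂, c₂, a', h₂, hq', ha'⟩ := h'.exists_connecting hT hX hk S
      refine Cech.sub_mem_range_of_mapCochain_eq hf hg S.injective S.surjective
        (S.exists_sub_eq hT hX hk) ha ha' ?_
      rw [hq, hq']
      exact hind _ _ _ _ h₁ h₂

end Step

end TowerData

theorem proposition4 {E : Type u} [Category.{v} E] [HasFiniteProducts E]
    (J : GrothendieckTopology E) (T : TowerData.{v, u, v', u', w} J) (n : ℕ)
    (hT : T.IsAbelianTowerOfTorsors n) {ι : Type t} (X : ι → E)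
    (hX : T.IsContractibleCover X n) (k : ℕ) (hk : k + 2 ≤ n) :
    (∃ x c, T.IsClassifying X k x c) ∧
    ∃ ξ : Cech.Cohomology X (T.L k).obj (k + 2),
      ∀ x c, T.IsClassifying X k x c →
        ∃ hc : c ∈ Cech.cocycles X (T.L k).obj (k + 2),
          Cech.cohomologyClass X (T.L k).obj (k + 2) ⟨c, hc⟩ = ξ := by
  obtain ⟨⟨x₀, c₀, h₀⟩, hd, hind⟩ := TowerData.isClassifying_exists_cocycle_unique hT hX k hk
  refine ⟨⟨x₀, c₀, h₀⟩, Cech.cohomologyClass X (T.L k).obj (k + 2) ⟨c₀, hd _ _ h₀⟩,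
    fun x c h => ⟨hd _ _ h, ?_⟩⟩
  refine QuotientAddGroup.eq.2 ?_
  rw [AddSubgroup.mem_addSubgroupOf]
  have := hind _ _ _ _ h₀ h
  rw [sub_eq_neg_add] at this
  exact this
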